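/- **Setting.** There are $n$ agents. Agent $i$ has a private value $v_i\ge 0$ for being served; $v_1,\dots,v_n$ are independent and $v_i$ has cumulative distribution function $F_i$. A feasibility constraint is a family $\mathcal F\subseteq 2^{[n]}$ of sets of agents that may be served simultaneously, with $\emptyset\in\mathcal F$ (serving nobody is allowed). A *public project* is the case $\mathcal F=\{\emptyset,[n]\}$. A (possibly randomized) mechanism maps each bid vector $b$ to a (random) set $A(b)\in\mathcal F$ of served agents and a (random) payment vector $p(b)\in\mathbb R^n$; an agent with value $v_i$ who is served with probability $\pi_i$ and whose expected payment is $p_i$ has utility $\pi_i v_i-p_i$. The mechanism is truthful if bidding one's value is a dominant strategy, and ex post individually rational if a served agent is never charged more than her bid and an unserved agent is never charged a positive amount. Its revenue is $\mathbb E\big[\sum_i p_i(v)\big]$. The revenue $\mathrm{OPT}(\mathcal F)$ of the optimal mechanism is the supremum of the revenues of all truthful, ex post individually rational mechanisms. The expected welfare of the efficient allocation is $W(\mathcal F)=\mathbb E\big[\max_{S\in\mathcal F}\sum_{i\in S}v_i\big]$. For a nonnegative random variable $X$ with cumulative distribution function $F$ put $\rho(X)=\sup_{p\ge 0}p\,(1-F(p))$.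 For $c>0$, $X$ is *$c$-bounded* if $\mathbb E[X]\le c\,\rho(X)$ and *strongly $c$-bounded* if $\Pr(X\le c\,\rho(X))=1$. **Theorem.** Let $n\ge 1$ and $c>0$. 1. For every feasibility constraint $\mathcal F$ with $\emptyset\in\mathcal F$, if all $v_i$ are strongly $c$-bounded, then $$\mathrm{OPT}(\mathcal F)\ \ge\ \frac{1}{96\,c\,\sqrt n}\;W(\mathcal F).$$ 2. For the public project $\mathcal F=\{\emptyset,[n]\}$, the same inequality holds if all $v_i$ are merely $c$-bounded. (Expectations and suprema may be $+\infty$; the inequalities are then understood in the extended reals.) -/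

import Mathlib

open MeasureTheory
open scoped ENNReal

noncomputable section

/-- The optimal revenue `sup_{p ≥ 0} p * (1 - F(p))` from selling an item to one agent whose
value has law `μ` (with distribution function `F`), as an element of `[0, ∞]`. -/
def rho (μ : Measure ℝ) : ℝ≥0∞ :=
  ⨆ p : ℝ, ⨆ _ : 0 ≤ p, ENNReal.ofReal p * μ (Set.Ioi p)

/-- `c`-bounded: the expected value is at most `c` times the single-agent optimal revenue. -/
def CBounded (c : ℝ) (μ : Measure ℝ) : Prop :=
  ∫⁻ x, ENNReal.ofReal x ∂μ ≤ ENNReal.ofReal c * rho μ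

/-- Strongly `c`-bounded: almost surely the value is at most `c` times the single-agent optimal
revenue. -/
def StronglyCBounded (c : ℝ) (μ : Measure ℝ) : Prop :=
  ∀ᵐ x ∂μ, ENNReal.ofReal x ≤ ENNReal.ofReal c * rho μ

/-- The public project: serve everyone or serve no one. -/
def publicProject (n : ℕ) : Set (Finset (Fin n)) := {∅, Finset.univ}

/-- A (possibly randomized) mechanism for `n` agents with feasibility constraint `F`. It maps a bid
vector and a random seed, uniform on `[0, 1]`, to a feasible set of served agents and a vector of
payments. -/
structure Mechanism (n : ℕ) (F : Set (Finset (Fin n))) where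
  /-- the set of agents served -/
  alloc : (Fin n → ℝ) → unitInterval → Finset (Fin n)
  /-- the amounts that the agents pay -/
  pay : (Fin n → ℝ) → unitInterval → Fin n → ℝ
  feasible : ∀ b r, alloc b r ∈ F
  measurableSet_alloc :
    ∀ i, MeasurableSet {x : (Fin n → ℝ) × unitInterval | i ∈ alloc x.1 x.2}
  measurable_pay : ∀ i, Measurable fun x : (Fin n → ℝ) × unitInterval => pay x.1 x.2 i
  /-- given the bids, expected payments are finite -/
  integrable_pay : ∀ b i, Integrable (fun r => pay b r i) volume

namespace Mechanism

variable {n : ℕ} {F : Set (Finset (Fin n))}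

/-- Probability that agent `i` is served when the bids are `b`. -/
def serveProb (M : Mechanism n F) (b : Fin n → ℝ) (i : Fin n) : ℝ :=
  (volume : Measure unitInterval).real {r | i ∈ M.alloc b r}

/-- Expected payment of agent `i` when the bids are `b`. -/
def expPay (M : Mechanism n F) (b : Fin n → ℝ) (i : Fin n) : ℝ :=
  ∫ r, M.pay b r i

/-- Quasi-linear utility of a risk-neutral agent `i` with value `x` when the bids are `b`. -/
def utility (M : Mechanism n F) (i : Fin n) (x : ℝ) (b : Fin n → ℝ) : ℝ :=
  M.serveProb b i * x - M.expPay b i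

/-- Bidding one's (nonnegative) value is a dominant strategy for every agent. -/
def Truthful (M : Mechanism n F) : Prop :=
  ∀ (i : Fin n) (b : Fin n → ℝ), 0 ≤ b i →
    ∀ y : ℝ, M.utility i (b i) (Function.update b i y) ≤ M.utility i (b i) b

/-- Ex post individual rationality: whatever the seed, an agent who is served is charged at most
her bid, and an agent who is not served is charged nothing. (Agents may also be paid.) -/
def ExPostIR (M : Mechanism n F) : Prop :=
  ∀ (b : Fin n → ℝ) (r : unitInterval) (i : Fin n), 0 ≤ b i →
    M.pay b r i ≤ if i ∈ M.alloc b r then b i else 0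

/-- Expected revenue `E[∑ i, p_i(v)]` when the values are independent with laws `μ i` and agents bid
truthfully, as the difference of the expectations of positive and negative part. If both are
infinite, the value is `⊥`. -/
def revenue (M : Mechanism n F) (μ : Fin n → Measure ℝ) : EReal :=
  ((∫⁻ x, ENNReal.ofReal (∑ i, M.pay x.1 x.2 i) ∂((Measure.pi μ).prod volume) : ℝ≥0∞) : EReal) -
  ((∫⁻ x, ENNReal.ofReal (-∑ i, M.pay x.1 x.2 i) ∂((Measure.pi μ).prod volume) : ℝ≥0∞) : EReal)

end Mechanism

/-- Optimal revenue: the supremum of the expected revenue over all truthful, ex post individually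
rational mechanisms. -/
def optRevenue {n : ℕ} (F : Set (Finset (Fin n))) (μ : Fin n → Measure ℝ) : EReal :=
  ⨆ M : Mechanism n F, ⨆ _ : M.Truthful ∧ M.ExPostIR, M.revenue μ

/-- Expected welfare `E[max_{S ∈ F} ∑ i ∈ S, v_i]` of the efficient allocation, in `[0, ∞]`, for
independent nonnegative values with laws `μ i`. -/
def optWelfare {n : ℕ} (F : Set (Finset (Fin n))) (μ : Fin n → Measure ℝ) : ℝ≥0∞ :=
  ∫⁻ v, (⨆ S ∈ F, ∑ i ∈ S, ENNReal.ofReal (v i)) ∂(Measure.pi μ)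

end

/-! Fix a feasible `S` and prices `p i`, zero outside `S`, accepted with probability `q i`. Serve
`S` when the virtual values of the yes/no answers have nonnegative sum (and the almost sure
acceptances occur), charging pivotal agents their prices. As in Myerson's theory, expected revenue
is the expected positive part of that sum (`randomSubsetExp_pivotal`, `randomSubsetExp_surplus`).

For `q i < 1` a summand has mean zero and is at least as spread out as a fair coin `± p i * q i`. A
fourth-moment argument bounds the revenue below by 2/9 of the Euclidean norm of the vector `p i * q
i`, hence, by Cauchy-Schwarz, by `2 / (9 * √n)` times its sum (`sum_le_randomSubsetExp_posPart`).

Optimizing the prices turns `p i * q i` into `rho (μ i)`. It remains to find `S` whose `rho`-sum,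
times `c`, bounds the welfare: a maximizer of that sum under strong boundedness, everyone for the
public project. -/

noncomputable section

/-! ### Random subsets and a Khintchine-type inequality -/

/-- Expectation of `f` over a random subset of `s` that contains each `i ∈ s` independently with
probability `q i`. -/
def randomSubsetExp {ι : Type*} [DecidableEq ι] (q : ι → ℝ) (s : Finset ι)
    (f : Finset ι → ℝ) : ℝ :=
  ∑ A ∈ s.powerset, (∏ j ∈ s, if j ∈ A then q j else 1 - q j) * f A

/-- Virtual value of an agent who is only asked whether her value exceeds the price `p i`, which
happens with probability `q i`; `A` is the set of agents who say yes. -/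
def binaryVirtualValue {ι : Type*} [DecidableEq ι] (p q : ι → ℝ) (A : Finset ι)
    (i : ι) : ℝ :=
  if i ∈ A then p i else -(p i * q i / (1 - q i))

section RandomSubset

variable {ι : Type*} [DecidableEq ι]

theorem randomSubsetExp_insert (q : ι → ℝ) {s : Finset ι} {a : ι} (ha : a ∉ s)
    (f : Finset ι → ℝ) :
    randomSubsetExp q (insert a s) f =
      randomSubsetExp q s fun A => q a * f (insert a A) + (1 - q a) * f A := by
  unfold randomSubsetExp
  rw [Finset.sum_powerset_insert ha, ← Finset.sum_add_distrib]
  refine Finset.sum_congr rfl fun A hA => ?_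
  have haA : a ∉ A := fun h => ha (Finset.mem_powerset.1 hA h)
  rw [Finset.prod_insert ha, Finset.prod_insert ha]
  have : ∏ j ∈ s, (if j ∈ insert a A then q j else 1 - q j)
      = ∏ j ∈ s, (if j ∈ A then q j else 1 - q j) := by
    refine Finset.prod_congr rfl fun j hj => ?_
    have : j ≠ a := fun h => ha (h ▸ hj)
    simp [this]
  rw [this]
  simp only [haA, if_false, Finset.mem_insert_self, if_true]
  ring

theorem randomSubsetExp_mono {q : ι → ℝ} (hq0 : ∀ i, 0 ≤ q i) (hq1 : ∀ i, q i ≤ 1) {s : Finset ι}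
    {f g : Finset ι → ℝ} (h : ∀ A ⊆ s, f A ≤ g A) :
    randomSubsetExp q s f ≤ randomSubsetExp q s g := by
  refine Finset.sum_le_sum fun A hA => mul_le_mul_of_nonneg_left (h A (Finset.mem_powerset.1 hA)) ?_
  refine Finset.prod_nonneg fun j _ => ?_
  split_ifs
  · exact hq0 j
  · linarith [hq1 j]

theorem randomSubsetExp_half_add (q : ι → ℝ) (s : Finset ι) (f g : Finset ι → ℝ) :
    randomSubsetExp q s (fun A => (f A + g A) / 2) =
      (randomSubsetExp q s f + randomSubsetExp q s g) / 2 := by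
  unfold randomSubsetExp
  rw [← Finset.sum_add_distrib, Finset.sum_div]
  exact Finset.sum_congr rfl fun A _ => by ring

theorem randomSubsetExp_sum {κ : Type*} (q : ι → ℝ) (s : Finset ι) (t : Finset κ)
    (f : κ → Finset ι → ℝ) :
    randomSubsetExp q s (fun A => ∑ k ∈ t, f k A) = ∑ k ∈ t, randomSubsetExp q s (f k) := by
  unfold randomSubsetExp
  simp only [Finset.mul_sum]
  exact Finset.sum_comm

/-- A centred two-point distribution dominates a fair coin flip inside its range, for the convex
function `max · 0`. -/
theorem half_posPart_add_posPart_le {p q : ℝ} (hp : 0 ≤ p) (hq0 : 0 ≤ q) (hq1 : q ≤ 1) (x : ℝ) :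
    (max (x + p * q) 0 + max (x - p * q) 0) / 2 ≤
      q * max (x + p) 0 + (1 - q) * max (x - p * q / (1 - q)) 0 := by
  -- At `q = 1` the quotient is `0` by convention, but its weight vanishes too.
  rcases eq_or_lt_of_le hq1 with rfl | hq
  · have : max (x - p) 0 ≤ max (x + p) 0 := max_le_max (by linarith) le_rfl
    simp only [mul_one, sub_self, zero_mul, one_mul, add_zero]
    linarith
  · have h1 : 0 < 1 - q := by linarith
    have e1 : q * max (x + p) 0 = max (q * x + p * q) 0 := by
      rw [mul_max_of_nonneg _ _ hq0]; ring_nf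
    have e2 : (1 - q) * max (x - p * q / (1 - q)) 0 = max ((1 - q) * x - p * q) 0 := by
      rw [mul_max_of_nonneg _ _ h1.le, mul_sub, mul_div_cancel₀ _ h1.ne', mul_zero]
    rw [e1, e2]
    have hpq : 0 ≤ p * q := mul_nonneg hp hq0
    generalize p * q = r at *
    have a1 := le_max_left (q * x + r) 0
    have a2 := le_max_right (q * x + r) 0
    have b1 := le_max_left ((1 - q) * x - r) 0
    have b2 := le_max_right ((1 - q) * x - r) 0
    rcases max_cases (x + r) 0 with ⟨h, h'⟩ | ⟨h, h'⟩ <;>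
      rcases max_cases (x - r) 0 with ⟨k, k'⟩ | ⟨k, k'⟩ <;> rw [h, k]
    · linarith
    · rcases le_total 0 x with hx | hx
      · nlinarith
      · nlinarith
    · linarith
    · linarith

/-- Since `max x 0 = (x + |x|) / 2`, an even quartic minorant of `|x|` suffices; its expectation
needs only second and fourth moments. The scale `t` is free. -/
theorem half_quartic_le_posPart {t : ℝ} (ht : 0 < t) (x : ℝ) :
    (x + x ^ 2 / t - x ^ 4 / (4 * t ^ 3)) / 2 ≤ max x 0 := by
  have h : max x 0 = (x + |x|) / 2 := by
    rcases le_total 0 x with hx | hx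
    · rw [max_eq_left hx, abs_of_nonneg hx]; ring
    · rw [max_eq_right hx, abs_of_nonpos hx]; ring
  have key : x ^ 2 / t - x ^ 4 / (4 * t ^ 3) ≤ |x| := by
    rw [← sq_abs, show x ^ 4 = |x| ^ 4 by rw [pow_abs, abs_of_nonneg (by positivity)]]
    have hy : 0 ≤ |x| := abs_nonneg x
    generalize |x| = y at *
    have : y - (y ^ 2 / t - y ^ 4 / (4 * t ^ 3)) =
        y * (4 * t ^ 3 - 4 * t ^ 2 * y + y ^ 3) / (4 * t ^ 3) := by
      field_simp
      ring
    have h2 : 0 ≤ 4 * t ^ 3 - 4 * t ^ 2 * y + y ^ 3 := by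
      -- The cubic equals `y(y-t)² + t(4y-5t)²/8 + 7t³/8`.
      nlinarith [mul_nonneg hy (sq_nonneg (y - t)),
        mul_nonneg ht.le (sq_nonneg (4 * y - 5 * t)), pow_pos ht 3]
    have : 0 ≤ y - (y ^ 2 / t - y ^ 4 / (4 * t ^ 3)) := by rw [this]; positivity
    linarith
  rw [h]; linarith

theorem sum_binaryVirtualValue_insert (p q : ι → ℝ) {s A : Finset ι} {a : ι} (ha : a ∉ s) :
    ∑ i ∈ insert a s, binaryVirtualValue p q (insert a A) i =
      p a + ∑ i ∈ s, binaryVirtualValue p q A i := by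
  rw [Finset.sum_insert ha]
  congr 1
  · simp [binaryVirtualValue]
  · refine Finset.sum_congr rfl fun j hj => ?_
    have : j ≠ a := fun h => ha (h ▸ hj)
    simp [binaryVirtualValue, this]

/-- Virtual values are replaced by fair coins `± p i * q i` one at a time; the shift `x` carries the
coins already flipped. With `V = ∑ (p i * q i)²`, the coin sum has variance `V` and fourth moment at
most `3V²`. -/
theorem quartic_le_randomSubsetExp {p q : ι → ℝ} (hp : ∀ i, 0 ≤ p i) (hq0 : ∀ i, 0 ≤ q i)
    (hq1 : ∀ i, q i ≤ 1) {t : ℝ} (ht : 0 < t) (s : Finset ι) (x : ℝ) :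
    (x + (x ^ 2 + ∑ i ∈ s, (p i * q i) ^ 2) / t - (x ^ 4 + 6 * x ^ 2 * ∑ i ∈ s, (p i * q i) ^ 2 +
        3 * (∑ i ∈ s, (p i * q i) ^ 2) ^ 2) / (4 * t ^ 3)) / 2 ≤
      randomSubsetExp q s fun A => max (x + ∑ i ∈ s, binaryVirtualValue p q A i) 0 := by
  induction s using Finset.induction_on generalizing x with
  | empty => simpa [randomSubsetExp] using half_quartic_le_posPart ht x
  | insert a s ha ih =>
    rw [randomSubsetExp_insert q ha, Finset.sum_insert ha]
    have h1 := ih (x + p a * q a)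
    have h2 := ih (x - p a * q a)
    have h3 : (randomSubsetExp q s fun A =>
        (max (x + p a * q a + ∑ i ∈ s, binaryVirtualValue p q A i) 0 +
        max (x - p a * q a + ∑ i ∈ s, binaryVirtualValue p q A i) 0) / 2) ≤
        randomSubsetExp q s fun A =>
          q a * max (x + ∑ i ∈ insert a s, binaryVirtualValue p q (insert a A) i) 0 +
          (1 - q a) * max (x + ∑ i ∈ insert a s, binaryVirtualValue p q A i) 0 := by
      refine randomSubsetExp_mono hq0 hq1 fun A hA => ?_
      have haA : a ∉ A := fun h => ha (hA h)
      have h := half_posPart_add_posPart_le (hp a) (hq0 a) (hq1 a)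
        (x + ∑ i ∈ s, binaryVirtualValue p q A i)
      rw [sum_binaryVirtualValue_insert p q ha, Finset.sum_insert ha]
      have e : binaryVirtualValue p q A a = -(p a * q a / (1 - q a)) := by
        simp [binaryVirtualValue, haA]
      rw [e]
      convert h using 3 <;> ring_nf
    rw [randomSubsetExp_half_add] at h3
    refine le_trans ?_ h3
    refine le_trans ?_ (div_le_div_of_nonneg_right (add_le_add h1 h2) zero_le_two)
    generalize p a * q a = r at *
    generalize ∑ i ∈ s, (p i * q i) ^ 2 = V at *
    rw [← sub_nonneg]
    -- This is the slack from bounding the fourth moment by `3V²`: each coin loses `2r⁴`.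
    have : 0 ≤ r ^ 4 / (4 * t ^ 3) := by positivity
    refine le_of_le_of_eq this ?_
    field_simp
    ring

/-- A Khintchine-type inequality. -/
theorem sum_le_randomSubsetExp_posPart {p q : ι → ℝ} (hp : ∀ i, 0 ≤ p i) (hq0 : ∀ i, 0 ≤ q i)
    (hq1 : ∀ i, q i ≤ 1) (s : Finset ι) :
    2 / 9 * ∑ i ∈ s, p i * q i ≤ √(s.card) *
      randomSubsetExp q s fun A => max (∑ i ∈ s, binaryVirtualValue p q A i) 0 := by
  have hpq : ∀ i, 0 ≤ p i * q i := fun i => mul_nonneg (hp i) (hq0 i)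
  set V := ∑ i ∈ s, (p i * q i) ^ 2 with hV
  have hV0 : 0 ≤ V := Finset.sum_nonneg fun i _ => sq_nonneg _
  have hcs : ∑ i ∈ s, p i * q i ≤ √(s.card) * √V := by
    rw [← Real.sqrt_mul (by positivity)]
    exact Real.le_sqrt_of_sq_le sq_sum_le_card_mul_sum_sq
  have hE : 2 / 9 * √V ≤
      randomSubsetExp q s fun A => max (∑ i ∈ s, binaryVirtualValue p q A i) 0 := by
    rcases hV0.eq_or_lt with h | h
    · rw [← h, Real.sqrt_zero, mul_zero]
      have := randomSubsetExp_mono hq0 hq1 (s := s) (f := fun _ => 0)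
        (g := fun A => max (∑ i ∈ s, binaryVirtualValue p q A i) 0) fun A _ => le_max_right _ _
      simpa [randomSubsetExp] using this
    · have hs : 0 < √V := Real.sqrt_pos.2 h
      -- At `x = 0` the bound is `(V/t - 3V²/(4t³))/2`, maximal at `t = 3/2 * √V`, where it is `2/9
      -- * √V`.
      have := quartic_le_randomSubsetExp hp hq0 hq1 (t := 3 / 2 * √V) (by positivity) s 0
      simp only [zero_add] at this
      refine le_trans (le_of_eq ?_) this
      rw [← hV, ← Real.sq_sqrt hV0, Real.sqrt_sq hs.le]
      field_simp
      ring
  calc 2 / 9 * ∑ i ∈ s, p i * q i ≤ 2 / 9 * (√(s.card) * √V) := by gcongr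
    _ = √(s.card) * (2 / 9 * √V) := by ring
    _ ≤ _ := by gcongr

end RandomSubset

/-! ### Pivotal payments and virtual surplus -/

/-- The sets of agents with nonnegative total virtual value that contain all agents who are
certain to accept their price. -/
def acceptedSets {ι : Type*} [Fintype ι] [DecidableEq ι] (p q : ι → ℝ) : Set (Finset ι) :=
  {A | (∀ i, q i = 1 → i ∈ A) ∧ 0 ≤ ∑ i, binaryVirtualValue p q A i}

section AcceptedSets

variable {ι : Type*} [Fintype ι] [DecidableEq ι]

theorem acceptedSets_mono {p q : ι → ℝ} (hp : ∀ i, 0 ≤ p i) (hq0 : ∀ i, 0 ≤ q i)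
    (hq1 : ∀ i, q i ≤ 1) {A B : Finset ι} (hAB : A ⊆ B) (hA : A ∈ acceptedSets p q) :
    B ∈ acceptedSets p q := by
  refine ⟨fun i hi => hAB (hA.1 i hi), hA.2.trans (Finset.sum_le_sum fun i _ => ?_)⟩
  have : 0 ≤ p i * q i / (1 - q i) :=
    div_nonneg (mul_nonneg (hp i) (hq0 i)) (by linarith [hq1 i])
  have := hp i
  unfold binaryVirtualValue
  split_ifs with h1 h2 h2
  · exact le_rfl
  · exact absurd (hAB h1) h2
  · linarith
  · exact le_rfl

open Classical in
/-- Expected payment of the pivotal agents equals expected virtual surplus. -/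
theorem randomSubsetExp_pivotal {p q : ι → ℝ} (hp : ∀ i, 0 ≤ p i) (hq0 : ∀ i, 0 ≤ q i)
    (hq1 : ∀ i, q i ≤ 1) (i : ι) :
    (randomSubsetExp q Finset.univ fun A =>
      if A ∈ acceptedSets p q ∧ A.erase i ∉ acceptedSets p q then p i else 0) =
    randomSubsetExp q Finset.univ fun A =>
      if A ∈ acceptedSets p q then binaryVirtualValue p q A i else 0 := by
  have huniv : (Finset.univ : Finset ι) = insert i (Finset.univ.erase i) := by simp
  rw [huniv, randomSubsetExp_insert q (by simp), randomSubsetExp_insert q (by simp)]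
  refine Finset.sum_congr rfl fun A hA => ?_
  have hiA : i ∉ A := fun h => by simpa using Finset.mem_powerset.1 hA h
  congr 1
  beta_reduce
  rw [Finset.erase_insert hiA, Finset.erase_eq_of_notMem hiA]
  have e1 : binaryVirtualValue p q (insert i A) i = p i := by simp [binaryVirtualValue]
  have e2 : binaryVirtualValue p q A i = -(p i * q i / (1 - q i)) := by
    simp [binaryVirtualValue, hiA]
  rw [e1, e2]
  by_cases h : A ∈ acceptedSets p q
  -- If `A` is accepted without `i`, nobody pays for `i` either way, and the virtual value of `i`
  -- averages to zero. This needs `q i ≠ 1`, which is why accepted sets must contain the certain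
  -- acceptors.
  · have hqi : 1 - q i ≠ 0 := fun h0 => hiA (h.1 i (by linarith))
    have h' := acceptedSets_mono hp hq0 hq1 (Finset.subset_insert i A) h
    simp only [h, h', not_true_eq_false, and_false, if_false, if_true]
    field_simp
    ring
  · simp [h]

open Classical in
theorem randomSubsetExp_surplus (p q : ι → ℝ) :
    (randomSubsetExp q Finset.univ fun A =>
      if A ∈ acceptedSets p q then ∑ i, binaryVirtualValue p q A i else 0) =
    randomSubsetExp q Finset.univ fun A => max (∑ i, binaryVirtualValue p q A i) 0 := by
  refine Finset.sum_congr rfl fun A _ => ?_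
  by_cases hD : ∀ i, q i = 1 → i ∈ A
  · congr 1
    beta_reduce
    split_ifs with h
    · exact (max_eq_left h.2).symm
    · exact (max_eq_right (not_le.1 fun h' => h ⟨hD, h'⟩).le).symm
  · push Not at hD
    obtain ⟨i, hi, hiA⟩ := hD
    -- A set missing a certain acceptor has probability zero.
    rw [Finset.prod_eq_zero (Finset.mem_univ i) (by simp [hiA, hi]), zero_mul, zero_mul]

open Classical in
theorem sum_le_randomSubsetExp_pivotal {p q : ι → ℝ} (hp : ∀ i, 0 ≤ p i) (hq0 : ∀ i, 0 ≤ q i)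
    (hq1 : ∀ i, q i ≤ 1) :
    2 / 9 * ∑ i, p i * q i ≤ √(Fintype.card ι) * randomSubsetExp q Finset.univ fun A =>
      ∑ i, if A ∈ acceptedSets p q ∧ A.erase i ∉ acceptedSets p q then p i else 0 := by
  rw [randomSubsetExp_sum, Finset.sum_congr rfl fun i _ => randomSubsetExp_pivotal hp hq0 hq1 i,
    ← randomSubsetExp_sum]
  have : (fun A : Finset ι => ∑ i, if A ∈ acceptedSets p q then binaryVirtualValue p q A i else 0) =
      fun A => if A ∈ acceptedSets p q then ∑ i, binaryVirtualValue p q A i else 0 := by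
    funext A; split_ifs <;> simp
  rw [this, randomSubsetExp_surplus]
  exact sum_le_randomSubsetExp_posPart hp hq0 hq1 Finset.univ

end AcceptedSets

/-! ### Law of the set of accepting agents -/

/-- The set of agents whose bid exceeds their price. -/
def acceptors {n : ℕ} (p b : Fin n → ℝ) : Finset (Fin n) :=
  Finset.univ.filter fun i => p i < b i

section Acceptors

variable {n : ℕ}

theorem measurable_comp_acceptors {β : Type*} [MeasurableSpace β] (p : Fin n → ℝ)
    (f : Finset (Fin n) → β) : Measurable fun b => f (acceptors p b) := by
  let _ : MeasurableSpace (Finset (Fin n)) := ⊤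
  have h : Measurable (acceptors p) := by
    refine measurable_to_countable' fun A => ?_
    have : acceptors p ⁻¹' {A} = ⋂ i, {b | i ∈ A ↔ p i < b i} := by
      ext b; simp [acceptors, Finset.ext_iff, iff_comm]
    rw [this]
    refine MeasurableSet.iInter fun i => ?_
    have hm : MeasurableSet {b : Fin n → ℝ | p i < b i} :=
      measurableSet_lt measurable_const (measurable_pi_apply i)
    by_cases hi : i ∈ A
    · simpa [hi] using hm
    · simp only [hi, false_iff]
      exact hm.compl
  exact (measurable_from_top (f := f)).comp h

theorem pi_acceptors_eq (μ : Fin n → Measure ℝ) [∀ i, IsProbabilityMeasure (μ i)]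
    (p : Fin n → ℝ) (A : Finset (Fin n)) :
    Measure.pi μ (acceptors p ⁻¹' {A}) = ENNReal.ofReal
      (∏ i, if i ∈ A then (μ i).real (Set.Ioi (p i)) else 1 - (μ i).real (Set.Ioi (p i))) := by
  have h : acceptors p ⁻¹' {A} =
      Set.univ.pi fun i => if i ∈ A then Set.Ioi (p i) else (Set.Ioi (p i))ᶜ := by
    ext b
    simp only [acceptors, Set.mem_preimage, Set.mem_singleton_iff, Finset.ext_iff,
      Finset.mem_filter, Finset.mem_univ, true_and, Set.mem_univ_pi]
    refine forall_congr' fun i => ?_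
    split_ifs with hi <;> simp [hi]
  rw [h, Measure.pi_pi, ENNReal.ofReal_prod_of_nonneg]
  · refine Finset.prod_congr rfl fun i _ => ?_
    split_ifs
    · exact (ofReal_measureReal).symm
    · rw [← probReal_compl_eq_one_sub measurableSet_Ioi, ofReal_measureReal]
  · intro i _
    split_ifs
    · exact measureReal_nonneg
    · linarith [measureReal_le_one (μ := μ i) (s := Set.Ioi (p i))]

theorem lintegral_comp_acceptors (μ : Fin n → Measure ℝ) [∀ i, IsProbabilityMeasure (μ i)]
    (p : Fin n → ℝ) {f : Finset (Fin n) → ℝ} (hf : ∀ A, 0 ≤ f A) :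
    ∫⁻ b, ENNReal.ofReal (f (acceptors p b)) ∂(Measure.pi μ) = ENNReal.ofReal
      (randomSubsetExp (fun i => (μ i).real (Set.Ioi (p i))) Finset.univ f) := by
  have hm : ∀ A, MeasurableSet (acceptors p ⁻¹' {A}) := fun A =>
    measurable_comp_acceptors p (fun B => B = A) (measurableSet_singleton True) |>.congr
      (by ext; simp)
  have h : ∀ b, ENNReal.ofReal (f (acceptors p b)) =
      ∑ A, (acceptors p ⁻¹' {A}).indicator (fun _ => ENNReal.ofReal (f A)) b := by
    intro b
    rw [Finset.sum_eq_single (acceptors p b)]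
    · simp
    · intro A _ hA
      exact Set.indicator_of_notMem (fun h => hA h.symm) _
    · simp
  simp_rw [h]
  rw [lintegral_finsetSum _ fun A _ => measurable_const.indicator (hm A)]
  unfold randomSubsetExp
  have hw : ∀ A : Finset (Fin n), 0 ≤
      ∏ i, if i ∈ A then (μ i).real (Set.Ioi (p i)) else 1 - (μ i).real (Set.Ioi (p i)) := by
    refine fun A => Finset.prod_nonneg fun i _ => ?_
    split_ifs
    · exact measureReal_nonneg
    · linarith [measureReal_le_one (μ := μ i) (s := Set.Ioi (p i))]
  rw [Finset.powerset_univ, ENNReal.ofReal_sum_of_nonneg fun A _ => mul_nonneg (hw A) (hf A)]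
  refine Finset.sum_congr rfl fun A _ => ?_
  rw [lintegral_indicator_const (hm A), pi_acceptors_eq, ENNReal.ofReal_mul (hw A), mul_comm]

end Acceptors

/-! ### The pivotal mechanism -/

namespace Mechanism

variable {n : ℕ} {F : Set (Finset (Fin n))}

open Classical in
/-- Serve `S` if the set of agents who accept their prices lies in `U`; agents who are pivotal for
this pay their prices. -/
def pivotal {S : Finset (Fin n)} (h0 : ∅ ∈ F) (hS : S ∈ F) (U : Set (Finset (Fin n)))
    (p : Fin n → ℝ) : Mechanism n F where
  alloc b _ := if acceptors p b ∈ U then S else ∅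
  pay b _ i := if acceptors p b ∈ U ∧ (acceptors p b).erase i ∉ U then p i else 0
  feasible b r := by split_ifs <;> assumption
  measurableSet_alloc i :=
    ((measurable_comp_acceptors p fun A => i ∈ if A ∈ U then S else ∅).comp measurable_fst).setOf
  measurable_pay i :=
    (measurable_comp_acceptors p fun A => if A ∈ U ∧ A.erase i ∉ U then p i else 0).comp
      measurable_fst
  integrable_pay b i := integrable_const _

variable {S : Finset (Fin n)} (h0 : ∅ ∈ F) (hS : S ∈ F) {U : Set (Finset (Fin n))}
  {p : Fin n → ℝ}

open Classical in
theorem pivotal_utility (i : Fin n) (x : ℝ) (b : Fin n → ℝ) :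
    (pivotal h0 hS U p).utility i x b =
      (if acceptors p b ∈ U ∧ i ∈ S then x else 0) -
        if acceptors p b ∈ U ∧ (acceptors p b).erase i ∉ U then p i else 0 := by
  unfold utility serveProb expPay pivotal
  congr 1
  · by_cases h : acceptors p b ∈ U <;> by_cases h' : i ∈ S <;> simp [h, h']
  · simp

theorem pivotal_exPostIR (hpS : ∀ i ∉ S, p i = 0) : (pivotal h0 hS U p).ExPostIR := by
  classical
  intro b r i hb
  simp only [pivotal]
  by_cases h : acceptors p b ∈ U
  · by_cases h' : (acceptors p b).erase i ∈ U
    · simp only [h, h', not_true_eq_false, and_false, if_false, if_true]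
      split_ifs <;> simp [hb]
    · have hi : i ∈ acceptors p b := by
        by_contra hi
        exact h' (by rwa [Finset.erase_eq_of_notMem hi])
      have : p i < b i := by simpa [acceptors] using hi
      by_cases hiS : i ∈ S
      · simp [h, h', hiS, this.le]
      · simp [h, hiS, hpS i hiS]
  · simp [h]

/-- For an upward closed `U`, the others' bids leave agent `i` three cases: service regardless of
her bid for free, no service, or a take-it-or-leave-it offer at `p i`. -/
theorem pivotal_truthful (hpS : ∀ i ∉ S, p i = 0) (hU : ∀ A ∈ U, ∀ B, A ⊆ B → B ∈ U) :
    (pivotal h0 hS U p).Truthful := by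
  classical
  intro i b hb y
  rw [pivotal_utility, pivotal_utility]
  by_cases hiS : i ∈ S
  swap
  · simp [hiS, hpS i hiS]
  have key : ∀ z, acceptors p (Function.update b i z) =
      if p i < z then insert i ((acceptors p b).erase i) else (acceptors p b).erase i := by
    intro z
    ext j
    by_cases hj : j = i
    · subst hj; split_ifs with h <;> simp [acceptors, h]
    · split_ifs <;> simp [acceptors, hj]
  have hb' := key (b i)
  rw [Function.update_eq_self] at hb'
  rw [key y]
  set A := (acceptors p b).erase i with hA
  have hiA : i ∉ A := Finset.notMem_erase i _
  have hsub : A ∈ U → insert i A ∈ U := fun h => hU A h _ (Finset.subset_insert i A)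
  rw [hb']
  clear_value A
  clear hA hb' key
  by_cases h1 : A ∈ U
  · have h2 := hsub h1
    split_ifs <;> simp_all
  · by_cases h2 : insert i A ∈ U
    · by_cases h3 : p i < b i <;> by_cases h4 : p i < y <;> simp [h1, h2, h3, h4, hiS, hiA]
      · exact h3.le
      · exact not_lt.1 h3
    · split_ifs <;> simp_all

open Classical in
theorem pivotal_revenue (μ : Fin n → Measure ℝ) [∀ i, IsProbabilityMeasure (μ i)]
    (hp : ∀ i, 0 ≤ p i) :
    (pivotal h0 hS U p).revenue μ = ((ENNReal.ofReal (randomSubsetExp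
      (fun i => (μ i).real (Set.Ioi (p i))) Finset.univ fun A =>
        ∑ i, if A ∈ U ∧ A.erase i ∉ U then p i else 0) : ℝ≥0∞) : EReal) := by
  have hpay : ∀ A, 0 ≤ ∑ i, if A ∈ U ∧ A.erase i ∉ U then p i else 0 := fun A =>
    Finset.sum_nonneg fun i _ => by split_ifs; exacts [hp i, le_rfl]
  rw [← lintegral_comp_acceptors μ p hpay]
  unfold revenue pivotal
  have hneg : ∀ x : (Fin n → ℝ) × unitInterval, ENNReal.ofReal (-∑ i,
      if acceptors p x.1 ∈ U ∧ (acceptors p x.1).erase i ∉ U then p i else 0) = 0 := fun x =>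
    ENNReal.ofReal_of_nonpos (neg_nonpos.2 (hpay _))
  simp only [hneg, lintegral_zero, EReal.coe_ennreal_zero, sub_zero]
  congr 1
  have hm : Measurable fun b : Fin n → ℝ => ENNReal.ofReal (∑ i,
      if acceptors p b ∈ U ∧ (acceptors p b).erase i ∉ U then p i else 0) :=
    measurable_comp_acceptors p fun A => ENNReal.ofReal (∑ i,
      if A ∈ U ∧ A.erase i ∉ U then p i else 0)
  exact measurePreserving_fst.lintegral_comp hm

end Mechanism

/-! ### From prices to revenue and welfare -/

section Bounds

variable {n : ℕ} {F : Set (Finset (Fin n))} {S : Finset (Fin n)}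
  (μ : Fin n → Measure ℝ) [∀ i, IsProbabilityMeasure (μ i)]

theorem sum_price_le_optRevenue (h0 : ∅ ∈ F) (hS : S ∈ F) {p : Fin n → ℝ} (hp : ∀ i, 0 ≤ p i) :
    ((ENNReal.ofReal (2 / (9 * √n)) * ∑ i ∈ S, ENNReal.ofReal (p i) * μ i (Set.Ioi (p i)) :
      ℝ≥0∞) : EReal) ≤ optRevenue F μ := by
  classical
  -- At price zero, agents outside `S` have virtual value zero and pay nothing.
  set p' : Fin n → ℝ := fun i => if i ∈ S then p i else 0
  have hp' : ∀ i, 0 ≤ p' i := fun i => by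
    simp only [p']; split_ifs; exacts [hp i, le_rfl]
  have hpS : ∀ i ∉ S, p' i = 0 := fun i hi => if_neg hi
  set q : Fin n → ℝ := fun i => (μ i).real (Set.Ioi (p' i))
  have hq0 : ∀ i, 0 ≤ q i := fun i => measureReal_nonneg
  have hq1 : ∀ i, q i ≤ 1 := fun i => measureReal_le_one
  have hrev := Mechanism.pivotal_revenue h0 hS (U := acceptedSets p' q) μ hp'
  refine le_trans ?_ (le_iSup₂_of_le (Mechanism.pivotal h0 hS (acceptedSets p' q) p')
    ⟨Mechanism.pivotal_truthful h0 hS hpS fun A hA B hAB => acceptedSets_mono hp' hq0 hq1 hAB hA,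
      Mechanism.pivotal_exPostIR h0 hS hpS⟩ le_rfl)
  rw [hrev, EReal.coe_ennreal_le_coe_ennreal_iff]
  have hsum : ∑ i ∈ S, ENNReal.ofReal (p i) * μ i (Set.Ioi (p i)) =
      ENNReal.ofReal (∑ i, p' i * q i) := by
    rw [ENNReal.ofReal_sum_of_nonneg fun i _ => mul_nonneg (hp' i) (hq0 i),
      ← Finset.sum_subset (Finset.subset_univ S) fun i _ hi => by simp [hpS i hi]]
    refine Finset.sum_congr rfl fun i hi => ?_
    rw [ENNReal.ofReal_mul (hp' i)]
    simp [p', q, hi]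
  rw [hsum, ← ENNReal.ofReal_mul (by positivity)]
  refine ENNReal.ofReal_le_ofReal ?_
  have key := sum_le_randomSubsetExp_pivotal hp' hq0 hq1
  rw [Fintype.card_fin] at key
  rcases Nat.eq_zero_or_pos n with rfl | hn
  · simp [randomSubsetExp]
  · have hs : 0 < √(n : ℝ) := Real.sqrt_pos.2 (by exact_mod_cast hn)
    rw [show 2 / (9 * √(n : ℝ)) * ∑ i, p' i * q i = (2 / 9 * ∑ i, p' i * q i) / √(n : ℝ) by
      field_simp, div_le_iff₀' hs]
    exact key

/-- The supremum may be infinite or unattained, so the price bound is passed to the limit. -/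
theorem exists_seq_price_tendsto_rho (ν : Measure ℝ) :
    ∃ u : ℕ → ℝ, (∀ k, 0 ≤ u k) ∧ Filter.Tendsto
      (fun k => ENNReal.ofReal (u k) * ν (Set.Ioi (u k))) Filter.atTop (nhds (rho ν)) := by
  have h : rho ν = sSup ((fun p => ENNReal.ofReal p * ν (Set.Ioi p)) '' Set.Ici 0) := by
    rw [sSup_image]; rfl
  obtain ⟨u, -, hu, hmem⟩ := exists_seq_tendsto_sSup
    (S := (fun p => ENNReal.ofReal p * ν (Set.Ioi p)) '' Set.Ici 0) ⟨_, 0, by simp, rfl⟩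
    (OrderTop.bddAbove _)
  choose w hw hw' using hmem
  refine ⟨w, hw, ?_⟩
  rw [h]
  simpa only [hw'] using hu

theorem sum_rho_le_optRevenue (h0 : ∅ ∈ F) (hS : S ∈ F) :
    ((ENNReal.ofReal (2 / (9 * √n)) * ∑ i ∈ S, rho (μ i) : ℝ≥0∞) : EReal) ≤ optRevenue F μ := by
  choose u hu0 hu using fun i => exists_seq_price_tendsto_rho (μ i)
  have hlim : Filter.Tendsto (fun k => ENNReal.ofReal (2 / (9 * √n)) *
      ∑ i ∈ S, ENNReal.ofReal (u i k) * μ i (Set.Ioi (u i k))) Filter.atTop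
      (nhds (ENNReal.ofReal (2 / (9 * √n)) * ∑ i ∈ S, rho (μ i))) :=
    ENNReal.Tendsto.const_mul (tendsto_finsetSum S fun i _ => hu i) (Or.inr ENNReal.ofReal_ne_top)
  exact le_of_tendsto ((continuous_coe_ennreal_ereal.tendsto _).comp hlim)
    (Filter.Eventually.of_forall fun k => sum_price_le_optRevenue μ h0 hS fun i => hu0 i k)

theorem welfare_bound_le_optRevenue (h0 : ∅ ∈ F) (hS : S ∈ F) {c : ℝ} (hc : 0 < c)
    (hW : optWelfare F μ ≤ ENNReal.ofReal c * ∑ i ∈ S, rho (μ i)) :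
    ((ENNReal.ofReal (1 / (96 * c * √n)) * optWelfare F μ : ℝ≥0∞) : EReal) ≤ optRevenue F μ := by
  refine le_trans ?_ (sum_rho_le_optRevenue μ h0 hS)
  rw [EReal.coe_ennreal_le_coe_ennreal_iff]
  calc ENNReal.ofReal (1 / (96 * c * √n)) * optWelfare F μ
      ≤ ENNReal.ofReal (1 / (96 * c * √n)) * (ENNReal.ofReal c * ∑ i ∈ S, rho (μ i)) := by gcongr
    _ = ENNReal.ofReal (1 / (96 * √n)) * ∑ i ∈ S, rho (μ i) := by
      rw [← mul_assoc, ← ENNReal.ofReal_mul (by positivity)]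
      congr 2
      field_simp
    _ ≤ _ := by
      gcongr ENNReal.ofReal ?_ * _
      rw [show 1 / (96 * √(n : ℝ)) = 1 / 96 * (√(n : ℝ))⁻¹ by ring,
        show 2 / (9 * √(n : ℝ)) = 2 / 9 * (√(n : ℝ))⁻¹ by ring]
      gcongr <;> norm_num

theorem exists_optWelfare_le_of_stronglyCBounded (h0 : ∅ ∈ F) {c : ℝ}
    (h : ∀ i, StronglyCBounded c (μ i)) :
    ∃ S ∈ F, optWelfare F μ ≤ ENNReal.ofReal c * ∑ i ∈ S, rho (μ i) := by
  -- This `S` is fixed before the values are drawn, yet almost surely it bounds the welfare of every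
  -- feasible set.
  obtain ⟨S, hS, hmax⟩ := F.toFinite.exists_maximalFor (fun S => ∑ i ∈ S, rho (μ i)) F ⟨∅, h0⟩
  refine ⟨S, hS, ?_⟩
  have hae : ∀ᵐ v ∂(Measure.pi μ), ∀ i, ENNReal.ofReal (v i) ≤ ENNReal.ofReal c * rho (μ i) :=
    ae_all_iff.2 fun i => (measurePreserving_eval μ i).quasiMeasurePreserving.ae (h i)
  calc optWelfare F μ ≤ ∫⁻ _, ENNReal.ofReal c * ∑ i ∈ S, rho (μ i) ∂(Measure.pi μ) := by
        refine lintegral_mono_ae (hae.mono fun v hv => iSup₂_le fun T hT => ?_)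
        calc ∑ i ∈ T, ENNReal.ofReal (v i) ≤ ∑ i ∈ T, ENNReal.ofReal c * rho (μ i) :=
              Finset.sum_le_sum fun i _ => hv i
          _ = ENNReal.ofReal c * ∑ i ∈ T, rho (μ i) := by rw [Finset.mul_sum]
          _ ≤ _ := by
            gcongr ENNReal.ofReal c * ?_
            exact (le_total _ _).elim id fun h => hmax hT h
    _ = _ := by simp

theorem optWelfare_publicProject_le {c : ℝ} (h : ∀ i, CBounded c (μ i)) :
    optWelfare (publicProject n) μ ≤ ENNReal.ofReal c * ∑ i, rho (μ i) := by
  calc optWelfare (publicProject n) μ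
      ≤ ∫⁻ v, ∑ i, ENNReal.ofReal (v i) ∂(Measure.pi μ) :=
        lintegral_mono fun v => iSup₂_le fun T _ =>
          Finset.sum_le_sum_of_subset (Finset.subset_univ T)
    _ = ∑ i, ∫⁻ x, ENNReal.ofReal x ∂(μ i) := by
        rw [lintegral_finsetSum _ fun i _ => (measurable_pi_apply i).ennreal_ofReal]
        exact Finset.sum_congr rfl fun i _ =>
          (measurePreserving_eval μ i).lintegral_comp ENNReal.measurable_ofReal
    _ ≤ _ := by
        rw [Finset.mul_sum]
        exact Finset.sum_le_sum fun i _ => h i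

end Bounds

end

theorem theorem1 (n : ℕ) (c : ℝ) (hc : 0 < c)
    (μ : Fin n → Measure ℝ) [∀ i, IsProbabilityMeasure (μ i)]
    (hμ : ∀ i, ∀ᵐ x ∂(μ i), 0 ≤ x) :
    (∀ F : Set (Finset (Fin n)), ∅ ∈ F → (∀ i, StronglyCBounded c (μ i)) →
      ((ENNReal.ofReal (1 / (96 * c * Real.sqrt n)) * optWelfare F μ : ℝ≥0∞) : EReal)
        ≤ optRevenue F μ) ∧
    ((∀ i, CBounded c (μ i)) →
      ((ENNReal.ofReal (1 / (96 * c * Real.sqrt n)) * optWelfare (publicProject n) μ : ℝ≥0∞) :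
        EReal) ≤ optRevenue (publicProject n) μ) := by
  refine ⟨fun F h0 h => ?_, fun h => ?_⟩
  · obtain ⟨S, hS, hW⟩ := exists_optWelfare_le_of_stronglyCBounded μ h0 h
    exact welfare_bound_le_optRevenue μ h0 hS hc hW
  · have h0 : ∅ ∈ publicProject n := Or.inl rfl
    have hS : Finset.univ ∈ publicProject n := Or.inr rfl
    exact welfare_bound_le_optRevenue μ h0 hS hc (optWelfare_publicProject_le μ h)
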